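/- For all positive integers $n$ and non-negative integers $k$, $$\det_{0\le i,j\le n-1}\left(\sum_{l=-k}^{k+1}\binom{2i+2j}{i+j+l}\right)= \begin{cases} (-1)^{n_1\binom{k+1}{2}}, & \text{if } n=(k+1)n_1 \text{ for an integer } n_1\ge 0,\\ (-1)^{n_1\binom{k+1}{2}}, & \text{if } n=(k+1)n_1+1 \text{ for an integer } n_1\ge 0,\\ 0, & \text{if } n\not\equiv 0,1 \pmod{k+1}. \end{cases}$$ Here $\binom{N}{m}$ is the binomial coefficient for integers $N\ge 0$ and $m$, understood to be $0$ if $m<0$ or $m>N$. (For $k=0$ the first two cases overlap; both give the value $1$.) -/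

import Mathlib

/-- The binomial coefficient `n` over `m` with a natural upper and an integer lower parameter;
it is zero if `m < 0` (and, by `Nat.choose`, if `m > n`). -/
def binomInt (n : ℕ) (m : ℤ) : ℤ :=
  if 0 ≤ m then (n.choose m.toNat : ℤ) else 0

/-!
Let `L N f` be the sum of the coefficients of `T ^ l`, `1 - N ≤ l ≤ N`, in `f (T + T⁻¹)`. As
`(T + 2 + T⁻¹) ^ m = T ^ (-m) * (1 + T) ^ (2 * m)`, the matrix in question has the entries
`L (k + 1) ((X + 2) ^ i * (X + 2) ^ j)`, and its determinant does not change when the powers of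
`X + 2` are replaced by other monic polynomials of the same degrees.

If `f` has degree at most `N`, the window misses only `T ^ (-N)`, so `L N f = f 2 - f.coeff N`.
Multiplication by `S_m (C_K)`, with the Chebyshev polynomials `C_K (T + T⁻¹) = T ^ K + T ^ (-K)` and
`S_m (T + T⁻¹) = T ^ m + T ^ (m - 2) + ⋯ + T ^ (-m)`, dilates the window:
`L K (S_m (C_K) * f) = L ((m + 1) * K) f`. With `K = k + 1`, the terms `f 2` therefore cancel in the
pairings of `S_m (C_K) - S_{m - 1} (C_K)` and of `S_m (C_K) * (X - 2) * X ^ t` with powers of `X`.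
List these polynomials by degree, in blocks of `K`, and pair them with the powers of `X`. Complete
blocks give a matrix that becomes triangular, with diagonal entries `1` and `-1`, on reversing all
rows but the first of each block. A single further row contributes another diagonal entry `1`, and
an incomplete block of more than one row contains a zero row.
-/

open Polynomial

section Determinants

open Equiv.Perm

theorem sign_neg_fin_succ (n : ℕ) :
    sign (Equiv.neg (Fin (n + 1))) = sign (Fin.revPerm : Equiv.Perm (Fin n)) := by
  have hneg : Equiv.neg (Fin (n + 1)) = decomposeFin.symm (0, Fin.revPerm) := by
    ext i
    cases i using Fin.cases with
    | zero => simp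
    | succ i =>
      simp only [Equiv.neg_apply, Fin.val_neg, if_neg (Fin.succ_ne_zero i), Fin.val_succ,
        decomposeFin_symm_apply_succ, Fin.revPerm_apply, Equiv.swap_self, Equiv.refl_apply,
        Fin.val_rev]
      omega
  rw [hneg, decomposeFin.symm_sign, if_pos rfl, one_mul]

theorem sign_fin_revPerm (n : ℕ) :
    sign (Fin.revPerm : Equiv.Perm (Fin n)) = (-1) ^ n.choose 2 := by
  induction n with
  | zero => rw [Subsingleton.elim (Fin.revPerm : Equiv.Perm (Fin 0)) 1]; simp
  | succ n ih =>
    have hrev : (Fin.revPerm : Equiv.Perm (Fin (n + 1))) =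
        (finRotate (n + 1)).trans (Equiv.neg (Fin (n + 1))) := by
      ext i
      rw [Equiv.trans_apply, Equiv.neg_apply, Fin.val_neg', Fin.revPerm_apply, Fin.val_rev]
      cases i using Fin.lastCases with
      | last => simp
      | cast j =>
        rw [finRotate_apply, Fin.coeSucc_eq_succ, Fin.val_succ, Fin.val_castSucc,
          Nat.mod_eq_of_lt (by omega)]
    rw [hrev, sign_trans, sign_neg_fin_succ, ih, sign_finRotate, ← pow_add, Nat.choose_succ_succ,
      Nat.choose_one_right, add_tsub_cancel_right, add_comm]

variable {R : Type*} [CommRing R]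

theorem det_eq_sign_mul_prod_of_eq_zero_of_lt {m : Type*} [Fintype m] [LinearOrder m]
    (M : Matrix m m R) (e : Equiv.Perm m) (h : ∀ i j, j < e i → M i j = 0) :
    M.det = sign e * ∏ i, M i (e i) := by
  have hT : (M.submatrix e.symm id).IsUpperTriangular := fun i j hij => h _ _ (by simpa using hij)
  calc M.det = sign e * (M.submatrix e.symm id).det := by
        rw [Matrix.det_permute, sign_symm, ← mul_assoc, ← Int.cast_mul, Int.units_coe_mul_self,
          Int.cast_one, one_mul]
    _ = sign e * ∏ i, M i (e i) := by
        rw [Matrix.det_of_isUpperTriangular hT, ← Equiv.prod_comp e]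
        simp only [Matrix.submatrix_apply, Equiv.symm_apply_apply, id]

theorem det_eq_mul_det_castSucc {n : ℕ} (M : Matrix (Fin (n + 1)) (Fin (n + 1)) R)
    (h : ∀ j : Fin n, M (Fin.last n) j.castSucc = 0) :
    M.det = M (Fin.last n) (Fin.last n) * (M.submatrix Fin.castSucc Fin.castSucc).det := by
  rw [Matrix.det_succ_row _ (Fin.last n), Fin.sum_univ_castSucc]
  simp [h, Fin.succAbove_last, ← two_mul]

theorem det_apply_eq_det_apply_X_pow {n : ℕ} (φ : Fin n → R[X] →ₗ[R] R) {p : Fin n → R[X]}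
    (hp : ∀ i, IsMonicOfDegree (p i) i) :
    (Matrix.of fun i j => φ j (p i)).det =
      (Matrix.of fun i j : Fin n => φ j (X ^ (i : ℕ))).det := by
  have hmul : (Matrix.of fun i j => φ j (p i)) =
      (Matrix.of fun i j : Fin n => (p j).coeff i).transpose *
        Matrix.of fun i j : Fin n => φ j (X ^ (i : ℕ)) := by
    ext i j
    rw [Matrix.of_apply, Matrix.mul_apply,
      (p i).as_sum_range' n ((hp i).natDegree_eq.trans_lt i.2), map_sum, Finset.sum_range]
    simp [← C_mul_X_pow_eq_monomial, ← smul_eq_C_mul]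
  rw [hmul, Matrix.det_mul, Matrix.det_transpose,
    Matrix.det_matrixOfPolynomials p (fun i => (hp i).natDegree_eq) (fun i => (hp i).monic),
    one_mul]

theorem det_bilin_eq_det_bilin_X_pow {n : ℕ} (B : R[X] →ₗ[R] R[X] →ₗ[R] R)
    {p q : Fin n → R[X]} (hp : ∀ i, IsMonicOfDegree (p i) i) (hq : ∀ i, IsMonicOfDegree (q i) i) :
    (Matrix.of fun i j => B (p i) (q j)).det =
      (Matrix.of fun i j : Fin n => B (X ^ (i : ℕ)) (X ^ (j : ℕ))).det := by
  calc (Matrix.of fun i j => B (p i) (q j)).det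
    _ = (Matrix.of fun i j : Fin n => B (X ^ (i : ℕ)) (q j)).det :=
        det_apply_eq_det_apply_X_pow (fun j => B.flip (q j)) hp
    _ = (Matrix.of fun i j : Fin n => B (X ^ (j : ℕ)) (q i)).det := (Matrix.det_transpose _).symm
    _ = (Matrix.of fun i j : Fin n => B (X ^ (j : ℕ)) (X ^ (i : ℕ))).det :=
        det_apply_eq_det_apply_X_pow (fun j => B (X ^ (j : ℕ))) hq
    _ = _ := Matrix.det_transpose _

end Determinants

section ChebyshevDegree

variable {R : Type*} [CommRing R] [Nontrivial R]

theorem isMonicOfDegree_of_recurrence {P : ℕ → R[X]} {d : ℕ}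
    (h0 : IsMonicOfDegree (P 0) d) (h1 : IsMonicOfDegree (P 1) (d + 1))
    (h : ∀ n, P (n + 2) = X * P (n + 1) - P n) (n : ℕ) : IsMonicOfDegree (P n) (n + d) := by
  induction n using Nat.twoStepInduction with
  | zero => rwa [zero_add]
  | one => rwa [add_comm]
  | more n ih0 ih1 =>
    have hX : IsMonicOfDegree (X * P (n + 1)) (n + 2 + d) := by
      convert (isMonicOfDegree_X R).mul ih1 using 1
      ring
    rw [h]
    exact hX.sub (ih0.natDegree_eq.trans_lt (by omega))

theorem isMonicOfDegree_chebyshev_S (n : ℕ) : IsMonicOfDegree (Chebyshev.S R n) n :=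
  isMonicOfDegree_of_recurrence (P := fun n : ℕ => Chebyshev.S R n) (d := 0)
    (by simp [isMonicOfDegree_zero_iff]) (by simpa using isMonicOfDegree_X R)
    (fun n => by simp [Chebyshev.S_add_two]) n

theorem isMonicOfDegree_chebyshev_C {n : ℕ} (hn : n ≠ 0) :
    IsMonicOfDegree (Chebyshev.C R n) n := by
  obtain ⟨n, rfl⟩ := Nat.exists_eq_succ_of_ne_zero hn
  have hC2 : IsMonicOfDegree (Chebyshev.C R 2) 2 := by
    rw [Chebyshev.C_two]
    exact (isMonicOfDegree_X_pow R 2).sub (by simp)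
  refine isMonicOfDegree_of_recurrence (P := fun n : ℕ => Chebyshev.C R (n + 1 : ℕ)) (d := 1)
    (by simpa using isMonicOfDegree_X R) (by simpa using hC2) (fun n => ?_) n
  have hrec := Chebyshev.C_add_two R (n + 1)
  push_cast
  rw [← hrec]
  ring_nf

end ChebyshevDegree

section NeighborSum

variable (R M : Type*) [CommRing R] [AddCommGroup M] [Module R M]

/-- The operator `a ↦ (N ↦ a (N + 1) + a (N - 1))` on two-sided sequences. It plays the role of
multiplication by `T + T⁻¹` on Laurent polynomials in `T`. -/
def neighborSum : Module.End R (ℤ → M) :=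
  LinearMap.funLeft R M (· + 1) + LinearMap.funLeft R M (· - 1)

variable {R M}

@[simp]
theorem neighborSum_apply (a : ℤ → M) (N : ℤ) : neighborSum R M a N = a (N + 1) + a (N - 1) := rfl

theorem aeval_neighborSum_X_mul (f : R[X]) (a : ℤ → M) (N : ℤ) :
    aeval (neighborSum R M) (X * f) a N =
      aeval (neighborSum R M) f a (N + 1) + aeval (neighborSum R M) f a (N - 1) := by
  rw [map_mul, aeval_X, Module.End.mul_apply, neighborSum_apply]

theorem aeval_neighborSum_chebyshev_C (n : ℤ) (a : ℤ → M) (N : ℤ) :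
    aeval (neighborSum R M) (Chebyshev.C R n) a N = a (N + n) + a (N - n) := by
  induction n using Chebyshev.induct' generalizing N with
  | zero => simp [map_ofNat, ← two_smul ℕ]
  | one => simp
  | add_two n ih1 ih0 =>
    rw [Chebyshev.C_add_two, map_sub, LinearMap.sub_apply, Pi.sub_apply, aeval_neighborSum_X_mul,
      ih1, ih1, ih0]
    ring_nf
    abel
  | neg n ih => rw [Chebyshev.C_neg, ih, sub_neg_eq_add, ← sub_eq_add_neg, add_comm]

theorem odd_aeval_neighborSum (f : R[X]) {a : ℤ → M} (ha : a.Odd) :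
    (aeval (neighborSum R M) f a).Odd := by
  induction f using Polynomial.induction_on' generalizing a with
  | add f g hf hg => simpa only [map_add, LinearMap.add_apply] using (hf ha).add (hg ha)
  | monomial n r =>
    rw [← C_mul_X_pow_eq_monomial, ← smul_eq_C_mul, map_smul, LinearMap.smul_apply]
    refine Function.Odd.const_smul ?_ r
    induction n with
    | zero => simpa using ha
    | succ n ih =>
      intro N
      rw [pow_succ', aeval_neighborSum_X_mul, aeval_neighborSum_X_mul, ← neg_add', ih,
        neg_add_eq_sub, ← neg_sub N, ih, ← neg_add, add_comm]

theorem aeval_neighborSum_chebyshev_S_comp_C [IsAddTorsionFree M] (m K : ℤ) {a : ℤ → M}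
    (ha : a.Odd) :
    aeval (neighborSum R M) ((Chebyshev.S R m).comp (Chebyshev.C R K)) a K = a ((m + 1) * K) := by
  rw [aeval_comp]
  set F := aeval (neighborSum R M) (Chebyshev.C R K)
  have hF (a : ℤ → M) (N : ℤ) : F a N = a (N + K) + a (N - K) :=
    aeval_neighborSum_chebyshev_C K a N
  have hmul (f : R[X]) (a : ℤ → M) : aeval F (X * f) a = aeval F f (F a) := by
    rw [mul_comm, map_mul, aeval_X, Module.End.mul_apply]
  have hodd {a : ℤ → M} (ha : a.Odd) : (F a).Odd := odd_aeval_neighborSum _ ha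
  induction m using Chebyshev.induct generalizing a with
  | zero => simp
  | one => simp [hF, ha.map_zero, one_add_one_eq_two, two_mul]
  | add_two n ih1 ih0 =>
    rw [Chebyshev.S_add_two, map_sub, LinearMap.sub_apply, Pi.sub_apply, hmul, ih1 (hodd ha),
      ih0 ha, hF]
    ring_nf
    abel
  | neg_add_one n ih0 ih1 =>
    rw [Chebyshev.S_sub_one, map_sub, LinearMap.sub_apply, Pi.sub_apply, hmul, ih0 (hodd ha),
      ih1 ha, hF]
    ring_nf
    abel

end NeighborSum

section WindowFunctional

/-- The functional whose moment matrices are to be evaluated: for `N ≥ 0`, the sum of the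
coefficients of `T ^ l` with `1 - N ≤ l ≤ N` in the Laurent polynomial `f (T + T⁻¹)`. It is
encoded through `neighborSum`, as `N ↦ N.sign` extends the window sums of the constant `1` to an odd
function of `N`. -/
noncomputable def windowFunctional (N : ℤ) : ℤ[X] →ₗ[ℤ] ℤ :=
  LinearMap.proj N ∘ₗ LinearMap.applyₗ Int.sign ∘ₗ (aeval (neighborSum ℤ ℤ)).toLinearMap

theorem windowFunctional_apply (N : ℤ) (f : ℤ[X]) :
    windowFunctional N f = aeval (neighborSum ℤ ℤ) f Int.sign N := rfl

theorem windowFunctional_one (N : ℤ) : windowFunctional N 1 = N.sign := by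
  simp [windowFunctional_apply]

theorem windowFunctional_X_mul (N : ℤ) (f : ℤ[X]) :
    windowFunctional N (X * f) = windowFunctional (N + 1) f + windowFunctional (N - 1) f :=
  aeval_neighborSum_X_mul f _ N

theorem odd_windowFunctional (f : ℤ[X]) : (fun N => windowFunctional N f).Odd :=
  odd_aeval_neighborSum f Int.sign_neg

theorem windowFunctional_X_pow {j N : ℕ} (hj : j ≤ N) :
    windowFunctional N (X ^ j) = 2 ^ j - if j = N then 1 else 0 := by
  induction j generalizing N with
  | zero =>
    rw [pow_zero, windowFunctional_one]
    cases N <;> simp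
  | succ j ih =>
    obtain ⟨N, rfl⟩ := Nat.exists_eq_add_of_le' hj
    have hright := ih (N := N + j + 2) (by omega)
    have hleft := ih (N := N + j) (by omega)
    rw [if_neg (by omega)] at hright
    push_cast at hright hleft
    rw [pow_succ', windowFunctional_X_mul]
    push_cast
    rw [show (N : ℤ) + (j + 1) + 1 = N + j + 2 by ring, show (N : ℤ) + (j + 1) - 1 = N + j by ring,
      hright, hleft, if_congr (show j = N + j ↔ j + 1 = N + (j + 1) by omega) rfl rfl]
    ring

theorem windowFunctional_eq_eval_two_sub_coeff {f : ℤ[X]} {N : ℕ} (hf : f.natDegree ≤ N) :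
    windowFunctional N f = f.eval 2 - f.coeff N := by
  refine induction_with_natDegree_le (fun f => windowFunctional N f = f.eval 2 - f.coeff N) N
    (by simp) (fun j r _ hj => ?_) (fun f g _ _ ihf ihg => ?_) f hf
  · rw [← smul_eq_C_mul, map_smul, windowFunctional_X_pow hj]
    simp [coeff_X_pow, eq_comm, mul_sub]
  · rw [map_add, ihf, ihg, eval_add, coeff_add]
    ring

theorem windowFunctional_X_add_two_mul (N : ℤ) (f : ℤ[X]) :
    windowFunctional N ((X + 2) * f) =
      windowFunctional (N + 1) f + windowFunctional (N - 1) f + 2 * windowFunctional N f := by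
  rw [add_mul, map_add, windowFunctional_X_mul, ← C_ofNat, ← smul_eq_C_mul, map_smul, smul_eq_mul]

theorem windowFunctional_chebyshev_S_comp_C_mul (m K : ℤ) (f : ℤ[X]) :
    windowFunctional K ((Chebyshev.S ℤ m).comp (Chebyshev.C ℤ K) * f) =
      windowFunctional ((m + 1) * K) f := by
  rw [windowFunctional_apply, map_mul, Module.End.mul_apply]
  exact aeval_neighborSum_chebyshev_S_comp_C m K (odd_windowFunctional f)

end WindowFunctional

section Binomial

theorem binomInt_natCast (n m : ℕ) : binomInt n m = n.choose m := by simp [binomInt]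

theorem binomInt_of_neg (n : ℕ) {m : ℤ} (hm : m < 0) : binomInt n m = 0 := if_neg hm.not_ge

theorem binomInt_succ_succ (n : ℕ) (m : ℤ) :
    binomInt (n + 1) (m + 1) = binomInt n m + binomInt n (m + 1) := by
  rcases lt_trichotomy m (-1) with hm | rfl | hm
  · rw [binomInt_of_neg _ (by omega), binomInt_of_neg _ (by omega), binomInt_of_neg _ (by omega),
      add_zero]
  · simp [binomInt]
  · obtain ⟨m, rfl⟩ := Int.eq_ofNat_of_zero_le (by omega : 0 ≤ m)
    rw [← Nat.cast_succ, binomInt_natCast, binomInt_natCast, binomInt_natCast]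
    exact_mod_cast Nat.choose_succ_succ n m

theorem binomInt_symm (n : ℕ) (m : ℤ) : binomInt n (n - m) = binomInt n m := by
  rcases lt_or_ge m 0 with hm | hm
  · obtain ⟨j, hj⟩ := Int.eq_ofNat_of_zero_le (by omega : 0 ≤ n - m)
    rw [binomInt_of_neg _ hm, hj, binomInt_natCast, Nat.choose_eq_zero_of_lt (by omega),
      Nat.cast_zero]
  · obtain ⟨j, rfl⟩ := Int.eq_ofNat_of_zero_le hm
    rcases le_or_gt j n with hj | hj
    · rw [← Nat.cast_sub hj, binomInt_natCast, binomInt_natCast, Nat.choose_symm hj]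
    · rw [binomInt_of_neg _ (by omega), binomInt_natCast, Nat.choose_eq_zero_of_lt hj,
        Nat.cast_zero]

theorem windowFunctional_add_one_sub_X_add_two_pow (m : ℕ) (N : ℤ) :
    windowFunctional (N + 1) ((X + 2) ^ m) - windowFunctional N ((X + 2) ^ m) =
      binomInt (2 * m + 1) (m + N + 1) := by
  induction m generalizing N with
  | zero =>
    simp only [pow_zero, windowFunctional_one, mul_zero, zero_add, Nat.cast_zero]
    rcases lt_trichotomy N (-1) with hN | rfl | hN
    · rw [binomInt_of_neg _ (by omega), Int.sign_eq_neg_one_of_neg (by omega),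
        Int.sign_eq_neg_one_of_neg (by omega), sub_self]
    · simp [binomInt]
    · obtain ⟨N, rfl⟩ := Int.eq_ofNat_of_zero_le (by omega : 0 ≤ N)
      rw [← Nat.cast_succ, binomInt_natCast]
      cases N with
      | zero => simp
      | succ N =>
        rw [Int.sign_natCast_of_ne_zero (by omega), Int.sign_natCast_of_ne_zero (by omega),
          Nat.choose_eq_zero_of_lt (by omega), Nat.cast_zero, sub_self]
  | succ m ih =>
    have hpascal (l : ℤ) : binomInt (2 * (m + 1) + 1) (l + 1 + 1) =
        binomInt (2 * m + 1) (l + 1 + 1) + 2 * binomInt (2 * m + 1) (l + 1) +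
          binomInt (2 * m + 1) l := by
      rw [show 2 * (m + 1) + 1 = 2 * m + 1 + 1 + 1 by ring]
      simp only [binomInt_succ_succ]
      ring
    have hleft := ih (N - 1)
    have hright := ih (N + 1)
    rw [sub_add_cancel, add_assoc, sub_add_cancel] at hleft
    rw [pow_succ', windowFunctional_X_add_two_mul, windowFunctional_X_add_two_mul, Nat.cast_succ,
      add_right_comm (m : ℤ) 1 N, hpascal, ← ih N, ← hleft, add_assoc (m : ℤ) N 1, ← hright,
      add_sub_cancel_right]
    ring

theorem windowFunctional_X_add_two_pow (m N : ℕ) :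
    windowFunctional N ((X + 2) ^ m) =
      ∑ l ∈ Finset.Icc (1 - N : ℤ) N, binomInt (2 * m) (m + l) := by
  induction N with
  | zero => simpa using (odd_windowFunctional _).map_zero
  | succ N ih =>
    have hsymm : binomInt (2 * m) (m + -N) = binomInt (2 * m) (m + N) := by
      rw [← binomInt_symm]
      push_cast
      ring_nf
    have hdiff := windowFunctional_add_one_sub_X_add_two_pow m N
    rw [binomInt_succ_succ, add_assoc, sub_eq_iff_eq_add, ih] at hdiff
    rw [Nat.cast_succ, hdiff, sub_add_cancel_right,
      ← Finset.insert_Icc_right_eq_Icc_add_one (by omega), Finset.sum_insert (by simp),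
      ← Finset.insert_Icc_add_one_left_eq_Icc (a := (-N : ℤ)) (by omega),
      Finset.sum_insert (by simp), hsymm, neg_add_eq_sub (N : ℤ) 1]
    ring

end Binomial

section QuasiOrthogonal

/-- The quasi-orthogonal polynomials for `windowFunctional K`: the block number `m` consists of
the monic polynomials `quasiOrthogonal K m t` of degree `K * m + t`, for `t < K`. -/
noncomputable def quasiOrthogonal (K m : ℕ) : ℕ → ℤ[X]
  | 0 => (Chebyshev.S ℤ m).comp (Chebyshev.C ℤ K) - (Chebyshev.S ℤ (m - 1)).comp (Chebyshev.C ℤ K)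
  | t + 1 => (Chebyshev.S ℤ m).comp (Chebyshev.C ℤ K) * ((X - 2) * X ^ t)

variable {K : ℕ}

theorem isMonicOfDegree_chebyshev_S_comp_C (hK : K ≠ 0) (m : ℕ) :
    IsMonicOfDegree ((Chebyshev.S ℤ m).comp (Chebyshev.C ℤ K)) (K * m) :=
  mul_comm m K ▸ (isMonicOfDegree_chebyshev_S m).comp hK (isMonicOfDegree_chebyshev_C hK)

theorem isMonicOfDegree_X_sub_two_mul_X_pow (t : ℕ) :
    IsMonicOfDegree ((X - 2) * X ^ t : ℤ[X]) (t + 1) :=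
  add_comm t 1 ▸ (isMonicOfDegree_X_sub_one (2 : ℤ)).mul (isMonicOfDegree_X_pow ℤ t)

theorem isMonicOfDegree_quasiOrthogonal (hK : K ≠ 0) (m t : ℕ) :
    IsMonicOfDegree (quasiOrthogonal K m t) (K * m + t) := by
  match t, m with
  | 0, 0 => simp [quasiOrthogonal, isMonicOfDegree_zero_iff]
  | 0, m + 1 =>
    have hlt : K * m < K * (m + 1) := Nat.mul_lt_mul_of_pos_left m.lt_succ_self hK.bot_lt
    rw [quasiOrthogonal, Nat.cast_succ, add_sub_cancel_right, ← Nat.cast_succ]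
    exact (isMonicOfDegree_chebyshev_S_comp_C hK (m + 1)).sub
      ((isMonicOfDegree_chebyshev_S_comp_C hK m).natDegree_eq.trans_lt hlt)
  | t + 1, m =>
    exact (isMonicOfDegree_chebyshev_S_comp_C hK m).mul (isMonicOfDegree_X_sub_two_mul_X_pow t)

theorem windowFunctional_quasiOrthogonal_zero_mul (hK : K ≠ 0) {m : ℕ} {f : ℤ[X]}
    (hf : f.natDegree ≤ K * m) :
    windowFunctional K (quasiOrthogonal K m 0 * f) = f.coeff (K * m) := by
  have hlt : K * m < K * (m + 1) := Nat.mul_lt_mul_of_pos_left m.lt_succ_self hK.bot_lt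
  have hinner := windowFunctional_eq_eval_two_sub_coeff hf
  have houter := windowFunctional_eq_eval_two_sub_coeff (hf.trans hlt.le)
  rw [coeff_eq_zero_of_natDegree_lt (hf.trans_lt hlt), sub_zero] at houter
  rw [quasiOrthogonal, sub_mul, map_sub, windowFunctional_chebyshev_S_comp_C_mul,
    windowFunctional_chebyshev_S_comp_C_mul, sub_add_cancel, mul_comm, mul_comm (m : ℤ)]
  push_cast at hinner houter
  rw [hinner, houter, sub_sub_cancel]

theorem windowFunctional_quasiOrthogonal_zero_mul_X_pow (hK : K ≠ 0) {m j : ℕ} (hj : j ≤ K * m) :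
    windowFunctional K (quasiOrthogonal K m 0 * X ^ j) = if j = K * m then 1 else 0 := by
  rw [windowFunctional_quasiOrthogonal_zero_mul hK (by rwa [natDegree_X_pow]), coeff_X_pow,
    if_congr eq_comm rfl rfl]

theorem windowFunctional_quasiOrthogonal_succ_mul_X_pow {m t j : ℕ}
    (hj : t + 1 + j ≤ K * (m + 1)) :
    windowFunctional K (quasiOrthogonal K m (t + 1) * X ^ j) =
      if t + 1 + j = K * (m + 1) then -1 else 0 := by
  have hmonic := isMonicOfDegree_X_sub_two_mul_X_pow (t + j)
  rw [add_right_comm] at hmonic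
  have hwindow := windowFunctional_eq_eval_two_sub_coeff (hmonic.natDegree_eq.trans_le hj)
  have hcoeff : ((X - 2) * X ^ (t + j) : ℤ[X]).coeff (K * (m + 1)) =
      if t + 1 + j = K * (m + 1) then 1 else 0 := by
    split_ifs with h
    · rw [← h]
      exact ((isMonicOfDegree_iff _ _).mp hmonic).2
    · exact coeff_eq_zero_of_natDegree_lt (hmonic.natDegree_eq.trans_lt (hj.lt_of_ne h))
  rw [quasiOrthogonal, mul_assoc, mul_assoc, ← pow_add, windowFunctional_chebyshev_S_comp_C_mul,
    mul_comm ((m : ℤ) + 1)]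
  push_cast at hwindow
  rw [hwindow, hcoeff]
  split_ifs <;> simp

end QuasiOrthogonal

section WindowPairing

/-- The matrix of `windowFunctional K (p * q)`, where `p` runs over the quasi-orthogonal
polynomials, listed by degree, and `q` over the powers of `X`. -/
noncomputable def windowPairing (K n : ℕ) : Matrix (Fin n) (Fin n) ℤ :=
  Matrix.of fun i j =>
    windowFunctional K (quasiOrthogonal K ((i : ℕ) / K) ((i : ℕ) % K) * X ^ (j : ℕ))

theorem det_windowPairing {K : ℕ} (hK : K ≠ 0) (n : ℕ) :
    (windowPairing K n).det = (Matrix.of fun i j : Fin n => ∑ l ∈ Finset.Icc (1 - K : ℤ) K,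
      binomInt (2 * (i : ℕ) + 2 * (j : ℕ)) (((i : ℕ) : ℤ) + ((j : ℕ) : ℤ) + l)).det := by
  let B : ℤ[X] →ₗ[ℤ] ℤ[X] →ₗ[ℤ] ℤ := (LinearMap.mul ℤ ℤ[X]).compr₂ (windowFunctional K)
  have hX2 (i : Fin n) : IsMonicOfDegree ((X + 2) ^ (i : ℕ) : ℤ[X]) i := by
    simpa using (isMonicOfDegree_X_add_one (2 : ℤ)).pow i
  have hquasi (i : Fin n) :
      IsMonicOfDegree (quasiOrthogonal K ((i : ℕ) / K) ((i : ℕ) % K)) i := by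
    simpa only [Nat.div_add_mod] using isMonicOfDegree_quasiOrthogonal hK (i / K) (i % K)
  have hbinom (i j : Fin n) : B ((X + 2) ^ (i : ℕ)) ((X + 2) ^ (j : ℕ)) =
      ∑ l ∈ Finset.Icc (1 - K : ℤ) K,
        binomInt (2 * (i : ℕ) + 2 * (j : ℕ)) (((i : ℕ) : ℤ) + ((j : ℕ) : ℤ) + l) := by
    rw [LinearMap.compr₂_apply, LinearMap.mul_apply', ← pow_add, windowFunctional_X_add_two_pow,
      mul_add, Nat.cast_add]
  simp only [← hbinom]
  exact (det_bilin_eq_det_bilin_X_pow B hquasi fun j => isMonicOfDegree_X_pow ℤ j).trans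
    (det_bilin_eq_det_bilin_X_pow B hX2 hX2).symm

theorem windowPairing_apply {K n m t : ℕ} (ht : t < K) {i : Fin n} (hi : (i : ℕ) = K * m + t)
    (j : Fin n) :
    windowPairing K n i j = windowFunctional K (quasiOrthogonal K m t * X ^ (j : ℕ)) := by
  rw [windowPairing, Matrix.of_apply, hi, Nat.mul_add_div (by omega), Nat.div_eq_of_lt ht, add_zero,
    Nat.mul_add_mod, Nat.mod_eq_of_lt ht]

theorem windowPairing_apply_finProdFinEquiv {k r : ℕ} (m : Fin r) (t : Fin (k + 1))
    {j : Fin (r * (k + 1))} (hj : j ≤ finProdFinEquiv (m, -t)) :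
    windowPairing (k + 1) (r * (k + 1)) (finProdFinEquiv (m, t)) j =
      if j = finProdFinEquiv (m, -t) then if t = 0 then 1 else -1 else 0 := by
  rw [windowPairing_apply t.2 (by rw [finProdFinEquiv_apply_val, add_comm]),
    if_congr Fin.ext_iff rfl rfl]
  rw [Fin.le_def] at hj
  simp only [finProdFinEquiv_apply_val] at hj ⊢
  cases t using Fin.cases with
  | zero =>
    simp only [neg_zero, Fin.val_zero, zero_add] at hj ⊢
    rw [windowFunctional_quasiOrthogonal_zero_mul_X_pow k.succ_ne_zero hj, if_pos trivial]
  | succ t =>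
    have hval : ((-t.succ : Fin (k + 1)) : ℕ) = k - t := by
      rw [Fin.val_neg, if_neg (Fin.succ_ne_zero t), Fin.val_succ, Nat.add_sub_add_right]
    have hm := mul_add_one (k + 1) (m : ℕ)
    have ht := t.2
    rw [hval] at hj ⊢
    rw [Fin.val_succ, windowFunctional_quasiOrthogonal_succ_mul_X_pow (by omega),
      if_neg (Fin.succ_ne_zero t)]
    exact if_congr (by omega) rfl rfl

/-- The permutation of the degrees that negates the position modulo `k + 1` inside each block of
length `k + 1`. It matches each row of `windowPairing (k + 1) (r * (k + 1))` with the column of its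
first nonzero entry. -/
def blockNeg (k r : ℕ) : Equiv.Perm (Fin (r * (k + 1))) :=
  finProdFinEquiv.permCongr (Equiv.prodCongrRight fun _ : Fin r => Equiv.neg (Fin (k + 1)))

theorem blockNeg_finProdFinEquiv {k r : ℕ} (m : Fin r) (t : Fin (k + 1)) :
    blockNeg k r (finProdFinEquiv (m, t)) = finProdFinEquiv (m, -t) := by
  simp [blockNeg, Equiv.permCongr_apply]

theorem sign_blockNeg (k r : ℕ) : Equiv.Perm.sign (blockNeg k r) = (-1) ^ (r * k.choose 2) := by
  rw [blockNeg, Equiv.Perm.sign_permCongr, Equiv.Perm.sign_prodCongrRight, Finset.prod_const,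
    sign_neg_fin_succ, sign_fin_revPerm, Finset.card_fin, ← pow_mul, mul_comm]

theorem det_windowPairing_mul (k r : ℕ) :
    (windowPairing (k + 1) ((k + 1) * r)).det = (-1) ^ (r * (k + 1).choose 2) := by
  rw [mul_comm (k + 1) r, det_eq_sign_mul_prod_of_eq_zero_of_lt _ (blockNeg k r), sign_blockNeg]
  · have hentry (m : Fin r) (t : Fin (k + 1)) :
        windowPairing (k + 1) (r * (k + 1)) (finProdFinEquiv (m, t))
          (blockNeg k r (finProdFinEquiv (m, t))) = if t = 0 then 1 else -1 := by
      rw [blockNeg_finProdFinEquiv, windowPairing_apply_finProdFinEquiv m t le_rfl, if_pos rfl]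
    have hprod : ∏ i, windowPairing (k + 1) (r * (k + 1)) i (blockNeg k r i) =
        (-1) ^ (r * k) := by
      rw [← Equiv.prod_comp finProdFinEquiv, Fintype.prod_prod_type, mul_comm r k, pow_mul]
      simp [hentry, Fin.prod_univ_succ]
    rw [hprod, Nat.choose_succ_succ, Nat.choose_one_right, mul_add, add_comm, pow_add]
    push_cast
    rfl
  · intro i j hij
    obtain ⟨⟨m, t⟩, rfl⟩ := finProdFinEquiv.surjective i
    rw [blockNeg_finProdFinEquiv] at hij
    rw [windowPairing_apply_finProdFinEquiv m t hij.le, if_neg hij.ne]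

theorem det_windowPairing_mul_add_one {K : ℕ} (hK : K ≠ 0) (r : ℕ) :
    (windowPairing K (K * r + 1)).det = (windowPairing K (K * r)).det := by
  have hlast (j : Fin (K * r + 1)) :
      windowPairing K (K * r + 1) (Fin.last _) j = if (j : ℕ) = K * r then 1 else 0 := by
    rw [windowPairing_apply (m := r) (Nat.pos_of_ne_zero hK) (by rw [Fin.val_last, add_zero]),
      windowFunctional_quasiOrthogonal_zero_mul_X_pow hK j.is_le]
  rw [det_eq_mul_det_castSucc _ fun j => by rw [hlast, Fin.val_castSucc, if_neg j.2.ne], hlast,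
    Fin.val_last, if_pos rfl, one_mul]
  rfl

theorem det_windowPairing_eq_zero {K n : ℕ} (hK : K ≠ 0) (h0 : ¬ n ≡ 0 [MOD K])
    (h1 : ¬ n ≡ 1 [MOD K]) : (windowPairing K n).det = 0 := by
  have hdivmod := Nat.div_add_mod n K
  have hlt : n % K < K := Nat.mod_lt n (Nat.pos_of_ne_zero hK)
  have hmod0 : n % K ≠ 0 := fun h => h0 (h.trans (Nat.zero_mod K).symm)
  have hK1 : 1 < K := by omega
  have hmod1 : n % K ≠ 1 := fun h => h1 (h.trans (Nat.mod_eq_of_lt hK1).symm)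
  have hblock : n < K * (n / K + 1) := by rw [mul_add_one]; omega
  refine Matrix.det_eq_zero_of_row_eq_zero ⟨K * (n / K) + 1, by omega⟩ fun j => ?_
  have hj := j.2
  rw [windowPairing_apply hK1 rfl, windowFunctional_quasiOrthogonal_succ_mul_X_pow (by omega),
    if_neg (by omega)]

end WindowPairing

theorem corollary17 (n k : ℕ) (hn : 1 ≤ n) :
    (∀ n₁ : ℕ, n = (k + 1) * n₁ →
      (Matrix.of fun i j : Fin n =>
        ∑ l ∈ Finset.Icc (-(k : ℤ)) ((k : ℤ) + 1),
          binomInt (2 * (i : ℕ) + 2 * (j : ℕ)) (((i : ℕ) : ℤ) + ((j : ℕ) : ℤ) + l)).det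
        = (-1 : ℤ) ^ (n₁ * (k + 1).choose 2)) ∧
    (∀ n₁ : ℕ, n = (k + 1) * n₁ + 1 →
      (Matrix.of fun i j : Fin n =>
        ∑ l ∈ Finset.Icc (-(k : ℤ)) ((k : ℤ) + 1),
          binomInt (2 * (i : ℕ) + 2 * (j : ℕ)) (((i : ℕ) : ℤ) + ((j : ℕ) : ℤ) + l)).det
        = (-1 : ℤ) ^ (n₁ * (k + 1).choose 2)) ∧
    (¬ n ≡ 0 [MOD k + 1] ∧ ¬ n ≡ 1 [MOD k + 1] →
      (Matrix.of fun i j : Fin n =>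
        ∑ l ∈ Finset.Icc (-(k : ℤ)) ((k : ℤ) + 1),
          binomInt (2 * (i : ℕ) + 2 * (j : ℕ)) (((i : ℕ) : ℤ) + ((j : ℕ) : ℤ) + l)).det
        = 0) := by
  have hdet := det_windowPairing k.succ_ne_zero n
  rw [Nat.cast_succ, sub_add_cancel_right] at hdet
  rw [← hdet]
  refine ⟨?_, ?_, fun h => det_windowPairing_eq_zero k.succ_ne_zero h.1 h.2⟩
  · rintro r rfl
    exact det_windowPairing_mul k r
  · rintro r rfl
    rw [det_windowPairing_mul_add_one k.succ_ne_zero, det_windowPairing_mul]
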